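/- A multicast network is a finite directed acyclic multigraph with a unique source node $s$ (the only node without incoming edges) and a set $T$ of receivers; the source dimension $\omega$ is the out-degree of $s$. A linear network code over a finite field $\mathrm{GF}(q)$ assigns a coefficient $k_{d,e}\in \mathrm{GF}(q)$ to every pair $(d,e)$ of edges, with $k_{d,e}=0$ unless $d$ enters the node that $e$ leaves. It determines coding vectors $f_e\in \mathrm{GF}(q)^{\omega}$: the vectors of the $\omega$ outgoing edges of $s$ are the standard unit vectors, and $f_e=\sum_d k_{d,e}f_d$ for every other edge $e$. The network is linearly solvable over $\mathrm{GF}(q)$ if for some such code the matrix $[f_e]_{e\in In(t)}$ has rank $\omega$ for every receiver $t\in T$, where $In(t)$ is the set of incoming edges of $t$. Let $q_{min}$ be the minimum size of a finite field over which the network is linearly solvable, and $q^*_{max}$ the maximum size of a finite field over which it is not linearly solvable ($q^*_{max}=1$ if it is linearly solvable over every finite field). For every prime $p$ there are infinitely many pairs $(p^k,q')$, with $k\ge 1$ and $q'$ a prime power, such that $q_{min}=p^k<q'=q^*_{max}$ for some multicast network. -/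

import Mathlib

/-- A multicast network: a finite directed acyclic multigraph (parallel edges are allowed) with a
unique source node and a set of receivers. Each `e : Edge` is a unit-capacity edge from the node
`tail e` to the node `head e`. -/
structure MulticastNetwork where
  Node : Type
  Edge : Type
  [finiteNode : Fintype Node]
  [finiteEdge : Fintype Edge]
  tail : Edge → Node
  head : Edge → Node
  /-- There is no directed cycle. -/
  acyclic : ∀ v : Node, ¬ Relation.TransGen (fun u w => ∃ e, tail e = u ∧ head e = w) v v
  source : Node
  /-- The source is the unique node without incoming edges. -/
  source_unique : ∀ v : Node, (∀ e, head e ≠ v) ↔ v = source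
  receivers : Set Node

namespace MulticastNetwork

attribute [instance] MulticastNetwork.finiteNode MulticastNetwork.finiteEdge

/-- The outgoing edges of the source. -/
abbrev SourceEdge (N : MulticastNetwork) : Type := {e : N.Edge // N.tail e = N.source}

/-- The incoming edges of a node. -/
abbrev In (N : MulticastNetwork) (v : N.Node) : Type := {e : N.Edge // N.head e = v}

open Classical in
/-- The source dimension: the out-degree of the source. -/
noncomputable def sourceDim (N : MulticastNetwork) : ℕ := Fintype.card N.SourceEdge

/-- A linear network code over `F`: a coding coefficient for every pair of edges, which vanishes
on the pairs `(d, e)` that are not adjacent. -/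
structure LinearCode (N : MulticastNetwork) (F : Type) [Field F] where
  coeff : N.Edge → N.Edge → F
  coeff_eq_zero : ∀ d e, N.head d ≠ N.tail e → coeff d e = 0

open Classical in
/-- `f` is the family of coding vectors of the linear network code `c`. The coordinates of the
coding vectors are indexed by the outgoing edges of the source (one data symbol for each of
them), whose coding vectors are the standard unit vectors; the coding vector of any other edge
is the combination, with the coding coefficients as weights, of the coding vectors of the edges.
As the network is acyclic, these equations have exactly one solution `f`. -/
def LinearCode.IsCodingVectors {N : MulticastNetwork} {F : Type} [Field F] (c : N.LinearCode F)
    (f : N.Edge → N.SourceEdge → F) : Prop :=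
  (∀ e : N.SourceEdge, f e = Pi.single e 1) ∧
    ∀ e : N.Edge, N.tail e ≠ N.source → f e = ∑ d, c.coeff d e • f d

open Classical in
/-- `N` is linearly solvable over `F`: there is a linear network code over `F` such that for each
receiver the matrix of the coding vectors of its incoming edges has full rank. -/
def LinearlySolvable (N : MulticastNetwork) (F : Type) [Field F] : Prop :=
  ∃ (c : N.LinearCode F) (f : N.Edge → N.SourceEdge → F), c.IsCodingVectors f ∧
    ∀ t ∈ N.receivers,
      (Matrix.of fun (i : N.SourceEdge) (e : N.In t) => f e i).rank = N.sourceDim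

/-- The sizes of the finite fields over which `N` is linearly solvable. -/
def solvableSizes (N : MulticastNetwork) : Set ℕ :=
  {q | ∃ (F : Type) (_ : Field F), Finite F ∧ Nat.card F = q ∧ N.LinearlySolvable F}

/-- The sizes of the finite fields over which `N` is not linearly solvable. -/
def unsolvableSizes (N : MulticastNetwork) : Set ℕ :=
  {q | ∃ (F : Type) (_ : Field F), Finite F ∧ Nat.card F = q ∧ ¬ N.LinearlySolvable F}

/-- `q = q_min`: the minimum field size for the existence of a linear solution. -/
def IsQMin (N : MulticastNetwork) (q : ℕ) : Prop := IsLeast N.solvableSizes q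

/-- `q = q*_max`: the maximum field size for the nonexistence of a linear solution, set to `1` if
the network is linearly solvable over all finite fields. -/
def IsQMax (N : MulticastNetwork) (q : ℕ) : Prop :=
  IsGreatest N.unsolvableSizes q ∨ (N.unsolvableSizes = ∅ ∧ q = 1)

end MulticastNetwork

/-! A network can encode a product-set question in the unit group of the field: it is solvable over
F exactly when F has at least n units and there are m sets of d units whose product set misses some
unit (`exists_network_iff_prod_ne`). Take n = p^k - 1 and p^k - 1 = d * r with r ≥ 2. The demand for
n units excludes all fields smaller than p^k, while over GF(p^k) the subgroup of order d, used m
times, never produces a generator. So q_min = p^k. Now let Q = 2 * 4^j > p^k and m = Q. The number Q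
- 1 is prime to 2, 3 and 5, so a proper subgroup of the units of GF(Q) has order at most (Q - 1) /
7. If this is below d, product sets of d-element sets keep growing until they fill the group, so
GF(Q) is not a solution field. Fields with at least d^m + n units always are, so q*_max exists and
is at least Q. It remains to find, for infinitely many k, an odd power of two Q just above p^k. -/

/-! ### Growth of product sets in a finite abelian group -/

open scoped Pointwise in
/-- The product of sufficiently many sets that are larger than every proper subgroup is the whole
group. -/
theorem exists_prod_eq_of_proper_subgroup_card_lt {G : Type} [CommGroup G] [Finite G] {d m : ℕ}
    (hd : 0 < d) (hG : ∀ H : Subgroup G, H ≠ ⊤ → Nat.card H < d) (hm : Nat.card G ≤ m)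
    (c : Fin m → Fin d → G) (hc : ∀ i, Function.Injective (c i)) (x : G) :
    ∃ j : Fin m → Fin d, ∏ i, c i (j i) = x := by
  classical
  have := Fintype.ofFinite G
  -- Each further factor enlarges the product set by at least one element until it is everything.
  have key : ∀ (n : ℕ) (c : Fin n → Fin d → G), (∀ i, Function.Injective (c i)) →
      (∀ x, ∃ j : Fin n → Fin d, ∏ i, c i (j i) = x) ∨
        n < (Finset.univ.image fun j : Fin n → Fin d => ∏ i, c i (j i)).card := by
    intro n
    induction n with
    | zero => intro c _; right; simp
    | succ n ih =>
      intro c hc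
      set P := Finset.univ.image fun j : Fin n → Fin d => ∏ i, c i.succ (j i) with hP
      set P' := Finset.univ.image fun j : Fin (n + 1) → Fin d => ∏ i, c i (j i) with hP'
      have hsub : ∀ a, c 0 a • P ⊆ P' := by
        intro a y hy
        obtain ⟨z, hz, rfl⟩ := Finset.mem_smul_finset.1 hy
        obtain ⟨j, -, rfl⟩ := Finset.mem_image.1 hz
        refine Finset.mem_image.2 ⟨Fin.cons a j, Finset.mem_univ _, ?_⟩
        simp [Fin.prod_univ_succ]
      let o : Fin d := ⟨0, hd⟩
      rcases ih (fun i => c i.succ) (fun i => hc i.succ) with hall | hlt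
      · left
        intro x
        obtain ⟨j, hj⟩ := hall ((c 0 o)⁻¹ * x)
        refine ⟨Fin.cons o j, ?_⟩
        simp [Fin.prod_univ_succ, hj]
      · change n < P.card at hlt
        have hle : P.card ≤ P'.card := by
          simpa using Finset.card_le_card (hsub o)
        rcases hle.lt_or_eq with h | h
        · right; omega
        · left
          have heq : ∀ a, c 0 a • P = P' := fun a =>
            Finset.eq_of_subset_of_card_le (hsub a) (by simp [h])
          -- Without growth all translates of `P` by elements of the new set coincide, so the d
          -- quotients of these elements lie in the stabilizer of `P`. It is then the whole group,
          -- and the nonempty `P` is everything.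
          let H := MulAction.stabilizer G P
          have hH : H = ⊤ := by
            by_contra hne
            refine absurd (hG H hne) (not_lt.2 ?_)
            let φ : Fin d → H := fun a => ⟨(c 0 o)⁻¹ * c 0 a, by
              rw [MulAction.mem_stabilizer_iff, mul_smul, heq a, ← heq o, inv_smul_smul]⟩
            have hφ : Function.Injective φ := by
              intro a b hab
              exact hc 0 (mul_left_cancel (congrArg Subtype.val hab))
            simpa using Nat.card_le_card_of_injective φ hφ
          obtain ⟨z, hz⟩ : P.Nonempty := Finset.card_pos.1 (by omega)
          intro x
          have hx : c 0 o • ((c 0 o)⁻¹ * x) ∈ P' := by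
            refine hsub o (Finset.smul_mem_smul_finset ?_)
            have hmem : (c 0 o)⁻¹ * x * z⁻¹ ∈ H := hH ▸ Subgroup.mem_top _
            rw [← MulAction.mem_stabilizer_iff.1 hmem]
            exact Finset.mem_smul_finset.2 ⟨z, hz, by simp⟩
          obtain ⟨j, -, hj⟩ := Finset.mem_image.1 hx
          exact ⟨j, by simpa using hj⟩
  rcases key m c hc with h | h
  · exact h x
  · have := h.trans_le (Finset.card_le_univ _)
    rw [Nat.card_eq_fintype_card] at hm
    omega

/-! ### Arithmetic of odd powers of two -/

/-- An odd power of two is 2 mod 3 and 2 or 3 mod 5, hence never 1 modulo 2, 3 or 5. This is why odd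
exponents are used. -/
theorem seven_le_of_dvd_two_mul_four_pow_sub_one {i j : ℕ} (hi : i ∣ 2 * 4 ^ j - 1)
    (h1 : i ≠ 1) : 7 ≤ i := by
  have hpos : 0 < 4 ^ j := by positivity
  have h0 : i ≠ 0 := by rintro rfl; rw [zero_dvd_iff] at hi; omega
  have h2 : ¬ 2 ∣ 2 * 4 ^ j - 1 := by omega
  have h3 : ¬ 3 ∣ 2 * 4 ^ j - 1 := by
    have : 4 ^ j % 3 = 1 := by rw [Nat.pow_mod]; simp
    omega
  have h5 : ¬ 5 ∣ 2 * 4 ^ j - 1 := by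
    have : 4 ^ j % 5 = 1 ∨ 4 ^ j % 5 = 4 := by
      clear * -
      induction j with
      | zero => simp
      | succ j ih => rw [pow_succ]; omega
    omega
  by_contra hlt
  have hlt' : i < 7 := not_le.1 hlt
  interval_cases i
  · exact h0 rfl
  · exact h1 rfl
  · exact h2 hi
  · exact h3 hi
  · exact h2 ((by norm_num : 2 ∣ 4).trans hi)
  · exact h5 hi
  · exact h2 ((by norm_num : 2 ∣ 6).trans hi)

theorem exists_two_mul_four_pow_between (x : ℕ) (hx : 0 < x) :
    ∃ j, x < 2 * 4 ^ j ∧ 2 * 4 ^ j ≤ 4 * x := by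
  have hex : ∃ j, x < 2 * 4 ^ j :=
    ⟨x, by have : x < 4 ^ x := Nat.lt_pow_self (by norm_num); omega⟩
  classical
  refine ⟨Nat.find hex, Nat.find_spec hex, ?_⟩
  rcases h : Nat.find hex with _ | j
  · simp; omega
  · have := Nat.find_min hex (m := j) (by omega)
    rw [pow_succ]; omega

/-- Either `x` or `x ^ 2` is followed closely by an odd power of two. -/
theorem exists_two_mul_four_pow_le_three_mul (x : ℕ) (hx : 0 < x) :
    (∃ j, x < 2 * 4 ^ j ∧ 2 * 4 ^ j ≤ 3 * x) ∨
      ∃ j, x ^ 2 < 2 * 4 ^ j ∧ 2 * 4 ^ j ≤ 3 * x ^ 2 := by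
  obtain ⟨j, h1, h2⟩ := exists_two_mul_four_pow_between x hx
  by_cases h3 : 2 * 4 ^ j ≤ 3 * x
  · exact .inl ⟨j, h1, h3⟩
  · right
    push Not at h3
    rcases j with _ | j
    · omega
    -- If Q lies in (3x, 4x], then the odd power of two Q^2 / 8 lies in (9/8 x^2, 2 x^2].
    · have e : 8 * (2 * 4 ^ (2 * j + 1)) = (2 * 4 ^ (j + 1)) ^ 2 := by
        rw [pow_succ 4 (2 * j), pow_mul', pow_succ 4 j]; ring
      refine ⟨2 * j + 1, ?_, ?_⟩ <;> nlinarith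

theorem card_subgroup_mul_seven_le {G : Type} [Group G] [Finite G] {j : ℕ}
    (hG : Nat.card G = 2 * 4 ^ j - 1) (H : Subgroup G) (hH : H ≠ ⊤) :
    Nat.card H * 7 ≤ 2 * 4 ^ j - 1 := by
  have h := H.card_mul_index
  rw [← hG, ← h]
  refine Nat.mul_le_mul_left _ (seven_le_of_dvd_two_mul_four_pow_sub_one (j := j) ?_ ?_)
  · rw [← hG]; exact H.index_dvd_card
  · rwa [Ne, Subgroup.index_eq_one]

/-! ### Layered networks: solvability as a choice of vectors with prescribed supports -/

namespace MulticastNetwork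

theorem rank_eq_card_iff_vecMul {A B F : Type} [Fintype A] [Fintype B] [Field F]
    (M : Matrix A B F) :
    M.rank = Fintype.card A ↔ ∀ y : A → F, (∀ b, ∑ a, y a * M a b = 0) → y = 0 := by
  rw [Matrix.rank_eq_finrank_span_row, eq_comm, ← Set.finrank,
    ← linearIndependent_iff_card_eq_finrank_span, Fintype.linearIndependent_iff]
  constructor
  · intro h y hy
    funext a
    refine h y ?_ a
    funext b
    simpa [Finset.sum_apply] using hy b
  · intro h y hy a
    refine congrFun (h y fun b => ?_) a
    simpa [Finset.sum_apply] using congrFun hy b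

namespace Layered

/-- The nodes of a layered network. -/
inductive Vertex (I K R : Type) : Type
  | origin : Vertex I K R
  | symbol : I → Vertex I K R
  | mixer : K → Vertex I K R
  | relay : K → Vertex I K R
  | sink : R → Vertex I K R

/-- The edges of a layered network. -/
inductive Arc {I K R : Type} (supp : I → K → Prop) (use : K → R → Prop) : Type
  | emit : I → Arc supp use
  | carry (i : I) (k : K) : supp i k → Arc supp use
  | mix : K → Arc supp use
  | deliver (k : K) (r : R) : use k r → Arc supp use

variable {I K R : Type} {supp : I → K → Prop} {use : K → R → Prop}

noncomputable instance [Fintype I] [Fintype K] [Fintype R] : Fintype (Vertex I K R) :=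
  Fintype.ofInjective
    (fun v : Vertex I K R => (match v with
      | .origin => none
      | .symbol i => some (.inl i)
      | .mixer k => some (.inr (.inl k))
      | .relay k => some (.inr (.inr (.inl k)))
      | .sink r => some (.inr (.inr (.inr r))) : Option (I ⊕ K ⊕ K ⊕ R)))
    (by rintro (_ | _ | _ | _ | _) (_ | _ | _ | _ | _) h <;> simp_all)

noncomputable instance [Fintype I] [Fintype K] [Fintype R] : Fintype (Arc supp use) :=
  Fintype.ofInjective
    (fun e : Arc supp use => (match e with
      | .emit i => .inl i
      | .carry i k _ => .inr (.inl (i, k))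
      | .mix k => .inr (.inr (.inl k))
      | .deliver k r _ => .inr (.inr (.inr (k, r))) : I ⊕ (I × K) ⊕ K ⊕ (K × R)))
    (by rintro (_ | _ | _ | _) (_ | _ | _ | _) h <;> simp_all)

/-- The node that an edge leaves. -/
def Arc.initial : Arc supp use → Vertex I K R
  | .emit _ => .origin
  | .carry i _ _ => .symbol i
  | .mix k => .mixer k
  | .deliver k _ _ => .relay k

/-- The node that an edge enters. -/
def Arc.target : Arc supp use → Vertex I K R
  | .emit i => .symbol i
  | .carry _ k _ => .mixer k
  | .mix k => .relay k
  | .deliver _ r _ => .sink r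

/-- The layer of a node. -/
def Vertex.layer : Vertex I K R → ℕ
  | .origin => 0
  | .symbol _ => 1
  | .mixer _ => 2
  | .relay _ => 3
  | .sink _ => 4

theorem Arc.layer_lt (e : Arc supp use) : e.initial.layer < e.target.layer := by
  cases e <;> simp [Arc.initial, Arc.target, Vertex.layer]

end Layered

open Layered

/-- The network in which every `k : K` stands for a bottleneck edge that carries a combination
of the symbols `i` with `supp i k`, and every `r : R` for a receiver of the `k` with `use k r`. -/
noncomputable def layered {I K R : Type} [Fintype I] [Fintype K] [Fintype R]
    (supp : I → K → Prop) (use : K → R → Prop)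
    (hsupp : ∀ k, ∃ i, supp i k) (huse : ∀ r, ∃ k, use k r) : MulticastNetwork where
  Node := Vertex I K R
  Edge := Arc supp use
  tail := Arc.initial
  head := Arc.target
  acyclic := by
    have key : ∀ u w : Vertex I K R,
        Relation.TransGen (fun u w => ∃ e : Arc supp use, e.initial = u ∧ e.target = w) u w →
        u.layer < w.layer := by
      intro u w h
      induction h with
      | single h => obtain ⟨e, rfl, rfl⟩ := h; exact e.layer_lt
      | tail _ h ih => obtain ⟨e, rfl, rfl⟩ := h; exact ih.trans e.layer_lt
    exact fun v h => lt_irrefl _ (key v v h)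
  source := .origin
  source_unique := by
    intro v
    constructor
    · intro h
      cases v with
      | origin => rfl
      | symbol i => exact absurd rfl (h (.emit i))
      | mixer k => obtain ⟨i, hi⟩ := hsupp k; exact absurd rfl (h (.carry i k hi))
      | relay k => exact absurd rfl (h (.mix k))
      | sink r => obtain ⟨k, hk⟩ := huse r; exact absurd rfl (h (.deliver k r hk))
    · rintro rfl e
      cases e <;> simp [Arc.target]
  receivers := Set.range Vertex.sink

section LayeredSolvable

variable {I K R : Type} [Fintype I] [Fintype K] [Fintype R]
  {supp : I → K → Prop} {use : K → R → Prop}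
  {hsupp : ∀ k, ∃ i, supp i k} {huse : ∀ r, ∃ k, use k r} {F : Type} [Field F]

/-- The source edges of a layered network correspond to the symbols. -/
def layeredSourceEquiv : I ≃ (layered supp use hsupp huse).SourceEdge where
  toFun i := ⟨Arc.emit i, rfl⟩
  invFun e := match e with
    | ⟨Arc.emit i, _⟩ => i
    | ⟨Arc.carry _ _ _, h⟩ => by simp [layered, Arc.initial] at h
    | ⟨Arc.mix _, h⟩ => by simp [layered, Arc.initial] at h
    | ⟨Arc.deliver _ _ _, h⟩ => by simp [layered, Arc.initial] at h
  left_inv i := rfl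
  right_inv e := by
    obtain ⟨e, he⟩ := e
    cases e with
    | emit i => rfl
    | _ => simp [layered, Arc.initial] at he

/-- Linear solvability of a layered network, with coding vectors indexed by the symbols. -/
theorem layered_solvable_iff_coeff [DecidableEq I] :
    (layered supp use hsupp huse).LinearlySolvable F ↔
      ∃ (C : Arc supp use → Arc supp use → F) (v : Arc supp use → I → F),
        (∀ a b, a.target ≠ b.initial → C a b = 0) ∧
        (∀ i, v (.emit i) = Pi.single i 1) ∧
        (∀ b, b.initial ≠ .origin → ∀ i, v b i = ∑ a, C a b * v a i) ∧
        ∀ r, ∀ y : I → F, (∀ k hk, ∑ i, y i * v (.deliver k r hk) i = 0) → y = 0 := by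
  classical
  let σ := layeredSourceEquiv (supp := supp) (use := use) (hsupp := hsupp) (huse := huse)
  have hsingle : ∀ i j, (Pi.single (σ i) 1 : _ → F) (σ j) = (Pi.single i 1 : I → F) j := by
    intro i j
    simp only [Pi.single_apply, σ.injective.eq_iff]
  constructor
  · rintro ⟨c, f, ⟨hf0, hf⟩, hr⟩
    refine ⟨c.coeff, fun a i => f a (σ i), c.coeff_eq_zero, ?_, ?_, ?_⟩
    · intro i
      funext j
      exact (congrFun (hf0 (σ i)) (σ j)).trans (by rw [← hsingle])
    · intro b hb i
      have := congrFun (hf b hb) (σ i)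
      rw [Finset.sum_apply] at this
      exact this
    · intro r y hy
      have h0 := (rank_eq_card_iff_vecMul _).1 (hr (.sink r) ⟨r, rfl⟩) (fun s => y (σ.symm s)) ?_
      · funext i
        exact (congrArg y (σ.symm_apply_apply i)).symm.trans (congrFun h0 (σ i))
      · rintro ⟨b, hb⟩
        rw [← Equiv.sum_comp σ]
        simp only [Equiv.symm_apply_apply]
        cases b with
        | deliver k r' hk =>
          obtain rfl : r' = r := Vertex.sink.inj hb
          exact hy k hk
        | _ => cases hb
  · rintro ⟨C, v, hC, hv0, hv, hr⟩
    refine ⟨⟨C, hC⟩, fun a s => v a (σ.symm s), ⟨?_, ?_⟩, ?_⟩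
    · intro e
      obtain ⟨i, rfl⟩ := σ.surjective e
      funext s
      obtain ⟨j, rfl⟩ := σ.surjective s
      refine (congrArg (v (.emit i)) (σ.symm_apply_apply j)).trans
        ((congrFun (hv0 i) j).trans (Eq.trans (hsingle i j).symm ?_))
      congr
    · intro e he
      funext s
      rw [Finset.sum_apply]
      exact hv e he _
    · rintro _ ⟨r, rfl⟩
      refine (rank_eq_card_iff_vecMul _).2 fun y hy => ?_
      have h0 : (fun i => y (σ i)) = 0 := by
        refine hr r _ fun k hk => ?_
        have := hy ⟨Arc.deliver k r hk, rfl⟩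
        rw [← Equiv.sum_comp σ] at this
        simp only [Matrix.of_apply, Equiv.symm_apply_apply] at this
        exact this
      funext s
      obtain ⟨j, rfl⟩ := σ.surjective s
      exact congrFun h0 j

/-- Together with the converse below, this removes the graph: only the vectors on the bottleneck
edges matter. -/
theorem layered_solvable_of_vectors (g : K → I → F) (hg : ∀ k i, ¬ supp i k → g k i = 0)
    (hr : ∀ r, ∀ y : I → F, (∀ k, use k r → ∑ i, y i * g k i = 0) → y = 0) :
    (layered supp use hsupp huse).LinearlySolvable F := by
  classical
  let coeff : Arc supp use → Arc supp use → F := fun a b => match a, b with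
    | .emit i, .carry i' _ _ => if i = i' then 1 else 0
    | .carry i k _, .mix k' => if k = k' then g k i else 0
    | .mix k, .deliver k' _ _ => if k = k' then 1 else 0
    | _, _ => 0
  let v : Arc supp use → I → F := fun a => match a with
    | .emit i => Pi.single i 1
    | .carry i _ _ => Pi.single i 1
    | .mix k => g k
    | .deliver k _ _ => g k
  have hcoeff : ∀ a b : Arc supp use, a.target ≠ b.initial → coeff a b = 0 := by
    intro a b h
    cases a <;> cases b <;> first
      | rfl
      | exact if_neg fun hab => h (by subst hab; rfl)
  have hv : ∀ b : Arc supp use, b.initial ≠ .origin → ∀ i, v b i = ∑ a, coeff a b * v a i := by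
    intro b hb i
    cases b with
    | emit i => exact absurd rfl hb
    | carry i' k h =>
      rw [Fintype.sum_eq_single (Arc.emit i')]
      · simp [coeff, v]
      · intro a ha
        cases a with
        | emit j =>
          have hj : j ≠ i' := by rintro rfl; exact ha rfl
          rw [show coeff (.emit j) (.carry i' k h) = 0 from if_neg hj, zero_mul]
        | _ => exact zero_mul _
    | mix k =>
      by_cases h : supp i k
      · rw [Fintype.sum_eq_single (Arc.carry i k h)]
        · simp [coeff, v]
        · intro a ha
          cases a with
          | carry i' k' h' =>
            by_cases hk : k' = k
            · subst hk
              have : i ≠ i' := by rintro rfl; exact ha rfl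
              rw [show v (.carry i' k' h') i = 0 from Pi.single_eq_of_ne this _, mul_zero]
            · rw [show coeff (.carry i' k' h') (.mix k) = 0 from if_neg hk, zero_mul]
          | _ => exact zero_mul _
      · rw [Finset.sum_eq_zero]
        · exact hg k i h
        · intro a _
          cases a with
          | carry i' k' h' =>
            by_cases hk : k' = k
            · subst hk
              have : i ≠ i' := by rintro rfl; exact h h'
              rw [show v (.carry i' k' h') i = 0 from Pi.single_eq_of_ne this _, mul_zero]
            · rw [show coeff (.carry i' k' h') (.mix k) = 0 from if_neg hk, zero_mul]
          | _ => exact zero_mul _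
    | deliver k r h =>
      rw [Fintype.sum_eq_single (Arc.mix k)]
      · simp [coeff, v]
      · intro a ha
        cases a with
        | mix k' =>
          have hk : k' ≠ k := by rintro rfl; exact ha rfl
          rw [show coeff (.mix k') (.deliver k r h) = 0 from if_neg hk, zero_mul]
        | _ => exact zero_mul _
  refine layered_solvable_iff_coeff.2 ⟨coeff, v, hcoeff, fun _ => rfl, hv, fun r y hy => ?_⟩
  exact hr r y hy

theorem exists_vectors_of_layered_solvable
    (h : (layered supp use hsupp huse).LinearlySolvable F) :
    ∃ g : K → I → F, (∀ k i, ¬ supp i k → g k i = 0) ∧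
      ∀ r, ∀ y : I → F, (∀ k, use k r → ∑ i, y i * g k i = 0) → y = 0 := by
  classical
  obtain ⟨C, v, hC, hv0, hv, hr⟩ := layered_solvable_iff_coeff.1 h
  -- An edge from a symbol to a mixer carries a multiple of one unit vector, which forces the
  -- support condition on the mixed vectors.
  have hcarry : ∀ i k (hik : supp i k) j, j ≠ i → v (.carry i k hik) j = 0 := by
    intro i k hik j hj
    rw [hv (.carry i k hik) (by simp [Arc.initial])]
    refine Finset.sum_eq_zero fun a _ => ?_
    by_cases ha : a = .emit i
    · subst ha
      simp [hv0, hj]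
    · rw [hC, zero_mul]
      rintro h
      cases a with
      | emit i' => exact ha (congrArg _ (Vertex.symbol.inj h))
      | _ => cases h
  refine ⟨fun k i => v (.mix k) i, ?_, ?_⟩
  · intro k i hik
    change v (.mix k) i = 0
    rw [hv (.mix k) (by simp [Arc.initial])]
    refine Finset.sum_eq_zero fun a _ => ?_
    by_cases ha : Arc.target a = .mixer k
    · cases a with
      | carry i' k' h' =>
        obtain rfl : k' = k := by simpa [Arc.target] using ha
        rw [hcarry i' k' h' i (by rintro rfl; exact hik h'), mul_zero]
      | _ => simp [Arc.target] at ha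
    · rw [hC _ _ ha, zero_mul]
  · intro r y hy
    refine hr r y fun k hk => ?_
    -- A relay has a single incoming edge, so it can only rescale its vector, and a rescaled vector
    -- imposes no condition that the original does not.
    have hd : ∀ i, v (.deliver k r hk) i = C (.mix k) (.deliver k r hk) * v (.mix k) i := by
      intro i
      rw [hv (.deliver k r hk) (by simp [Arc.initial])]
      refine Fintype.sum_eq_single (Arc.mix k) ?_
      intro a ha
      rw [hC, zero_mul]
      cases a with
      | mix k' =>
        exact fun h => ha (congrArg _ (Vertex.relay.inj h))
      | _ => exact fun h => by cases h
    simp only [hd, mul_left_comm _ (C _ _), ← Finset.mul_sum]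
    rw [hy k hk, mul_zero]

end LayeredSolvable

end MulticastNetwork

/-! ### From vectors to ratios of units, and to product sets -/

namespace MulticastNetwork

/-- A network whose solvability amounts to a choice of nonzero ratios `ρ s`, one for each vector in
the span of two basis vectors `lo s` and `hi s`, that are distinct on equal spans and for which
each of the systems `y (hi s) = ρ s * y (lo s)`, `s ∈ sel t`, has only the zero solution. -/
theorem exists_network_iff_ratios {I S T : Type} [Finite I] [Finite S] [Finite T]
    (lo hi : S → I) (hne : ∀ s, lo s ≠ hi s) (sel : T → Set S) (hsel : ∀ t, (sel t).Nonempty) :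
    ∃ N : MulticastNetwork, ∀ (F : Type) [Field F], N.LinearlySolvable F ↔
      ∃ ρ : S → Fˣ, (∀ s s', lo s = lo s' → hi s = hi s' → ρ s = ρ s' → s = s') ∧
        ∀ t, ∀ y : I → F, (∀ s ∈ sel t, y (hi s) = ρ s * y (lo s)) → y = 0 := by
  classical
  have := Fintype.ofFinite I
  have := Fintype.ofFinite S
  have := Fintype.ofFinite T
  let P := {q : S × S // q.1 ≠ q.2 ∧ lo q.1 = lo q.2 ∧ hi q.1 = hi q.2}
  let supp : I → I ⊕ S → Prop := fun i k =>
    Sum.elim (fun l => i = l) (fun s => i = lo s ∨ i = hi s) k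
  -- The first two kinds of receiver force the `lo` and `hi` coordinates of a vector to be nonzero,
  -- the third makes vectors in the same plane nonproportional, and the fourth imposes the linear
  -- systems.
  let use : I ⊕ S → S ⊕ S ⊕ P ⊕ T → Prop := fun k r => match k, r with
    | .inl l, .inl s => l ≠ lo s
    | .inl l, .inr (.inl s) => l ≠ hi s
    | .inl l, .inr (.inr (.inl q)) => l ≠ lo q.1.1 ∧ l ≠ hi q.1.1
    | .inl _, .inr (.inr (.inr _)) => False
    | .inr s', .inl s => s' = s
    | .inr s', .inr (.inl s) => s' = s
    | .inr s', .inr (.inr (.inl q)) => s' = q.1.1 ∨ s' = q.1.2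
    | .inr s', .inr (.inr (.inr t)) => s' ∈ sel t
  have hsupp : ∀ k, ∃ i, supp i k := by
    rintro (l | s)
    · exact ⟨l, rfl⟩
    · exact ⟨lo s, .inl rfl⟩
  have huse : ∀ r, ∃ k, use k r := by
    rintro (s | s | q | t)
    · exact ⟨.inr s, rfl⟩
    · exact ⟨.inr s, rfl⟩
    · exact ⟨.inr q.1.1, .inl rfl⟩
    · obtain ⟨s, hs⟩ := hsel t
      exact ⟨.inr s, hs⟩
  refine ⟨layered supp use hsupp huse, fun F _ => ⟨fun h => ?_, ?_⟩⟩
  · obtain ⟨g, hg, hr⟩ := exists_vectors_of_layered_solvable h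
    have hunit : ∀ (y : I → F) l, ∑ i, y i * g (.inl l) i = y l * g (.inl l) l := fun y l =>
      Fintype.sum_eq_single l fun i hi => by rw [hg (.inl l) i hi, mul_zero]
    have hpair : ∀ (y : I → F) s, ∑ i, y i * g (.inr s) i =
        y (lo s) * g (.inr s) (lo s) + y (hi s) * g (.inr s) (hi s) := fun y s =>
      Fintype.sum_eq_add _ _ (hne s) fun i hi => by rw [hg (.inr s) i (not_or.2 hi), mul_zero]
    have ha : ∀ s, g (.inr s) (lo s) ≠ 0 := by
      intro s h0
      have := hr (.inl s) (Pi.single (lo s) 1) ?_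
      · simpa using congrFun this (lo s)
      · rintro (l | s') hk
        · rw [hunit, Pi.single_eq_of_ne hk, zero_mul]
        · obtain rfl : s' = s := hk
          rw [hpair, h0, Pi.single_eq_of_ne (hne s').symm]
          simp
    have hb : ∀ s, g (.inr s) (hi s) ≠ 0 := by
      intro s h0
      have := hr (.inr (.inl s)) (Pi.single (hi s) 1) ?_
      · simpa using congrFun this (hi s)
      · rintro (l | s') hk
        · rw [hunit, Pi.single_eq_of_ne hk, zero_mul]
        · obtain rfl : s' = s := hk
          rw [hpair, h0, Pi.single_eq_of_ne (hne s')]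
          simp
    -- With this ratio, orthogonality of `y` to the vector of `s` reads `y (hi s) = ρ s * y (lo s)`.
    have hρ : ∀ s, -g (.inr s) (lo s) / g (.inr s) (hi s) ≠ 0 := fun s =>
      div_ne_zero (neg_ne_zero.2 (ha s)) (hb s)
    have hzero : ∀ s (y : I → F),
        y (hi s) = (-g (.inr s) (lo s) / g (.inr s) (hi s)) * y (lo s) →
        ∑ i, y i * g (.inr s) i = 0 := by
      intro s y hy
      have := hb s
      rw [hpair, hy]
      field_simp
      ring
    refine ⟨fun s => Units.mk0 _ (hρ s), ?_, ?_⟩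
    · intro s s' hlo hhi hss
      by_contra hcon
      have hss' : -g (.inr s) (lo s) / g (.inr s) (hi s) =
          -g (.inr s') (lo s') / g (.inr s') (hi s') := congrArg Units.val hss
      -- Equal ratios would make this nonzero vector orthogonal to everything the third kind of
      -- receiver gets.
      let y : I → F := fun l => if l = lo s then 1 else
        if l = hi s then -g (.inr s) (lo s) / g (.inr s) (hi s) else 0
      have hy1 : y (lo s) = 1 := if_pos rfl
      have hy2 : y (hi s) = -g (.inr s) (lo s) / g (.inr s) (hi s) :=
        (if_neg (hne s).symm).trans (if_pos rfl)
      have := hr (.inr (.inr (.inl ⟨(s, s'), hcon, hlo, hhi⟩))) y ?_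
      · simp [this] at hy1
      · rintro (l | u) hk
        · obtain ⟨h1, h2⟩ : l ≠ lo s ∧ l ≠ hi s := hk
          rw [hunit, show y l = 0 from (if_neg h1).trans (if_neg h2), zero_mul]
        · obtain rfl | rfl : u = s ∨ u = s' := hk
          · exact hzero _ _ (by rw [hy1, hy2, mul_one])
          · exact hzero _ _ (by rw [← hlo, ← hhi, hy1, hy2, mul_one, hss', hlo, hhi])
    · intro t y hy
      refine hr (.inr (.inr (.inr t))) y ?_
      rintro (l | s) hk
      · exact hk.elim
      · exact hzero s y (hy s hk)
  · rintro ⟨ρ, hinj, hcyc⟩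
    let g : I ⊕ S → I → F := fun k i => Sum.elim (fun l => if i = l then 1 else 0)
      (fun s => if i = lo s then (ρ s : F) else if i = hi s then -1 else 0) k
    have hunit : ∀ (y : I → F) l, ∑ i, y i * g (.inl l) i = y l := by
      intro y l
      simp [g]
    have hpair : ∀ (y : I → F) s, ∑ i, y i * g (.inr s) i = y (lo s) * ρ s - y (hi s) := by
      intro y s
      rw [Fintype.sum_eq_add _ _ (hne s)]
      · simp [g, (hne s).symm, sub_eq_add_neg]
      · rintro i ⟨h1, h2⟩
        simp [g, h1, h2]
    refine layered_solvable_of_vectors g ?_ ?_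
    · rintro (l | s) i h
      · exact if_neg h
      · exact (if_neg fun h' => h (.inl h')).trans (if_neg fun h' => h (.inr h'))
    · rintro (s | s | q | t) y hy
      · have hl : ∀ l, l ≠ lo s → y l = 0 := fun l h => (hunit y l).symm.trans (hy (.inl l) h)
        have hs := (hpair y s).symm.trans (hy (.inr s) rfl)
        rw [hl _ (hne s).symm, sub_zero] at hs
        funext l
        by_cases h : l = lo s
        · rw [h]; simpa using hs
        · exact hl l h
      · have hl : ∀ l, l ≠ hi s → y l = 0 := fun l h => (hunit y l).symm.trans (hy (.inl l) h)
        have hs := (hpair y s).symm.trans (hy (.inr s) rfl)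
        rw [hl _ (hne s), zero_mul, zero_sub, neg_eq_zero] at hs
        funext l
        by_cases h : l = hi s
        · rw [h]; exact hs
        · exact hl l h
      · obtain ⟨⟨s, s'⟩, hss, hlo, hhi⟩ := q
        dsimp only at hss hlo hhi
        have hl : ∀ l, l ≠ lo s → l ≠ hi s → y l = 0 := fun l h h' =>
          (hunit y l).symm.trans (hy (.inl l) ⟨h, h'⟩)
        have hs := (hpair y s).symm.trans (hy (.inr s) (.inl rfl))
        have hs' := (hpair y s').symm.trans (hy (.inr s') (.inr rfl))
        rw [← hlo, ← hhi] at hs'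
        have hρ : (ρ s : F) - ρ s' ≠ 0 := by
          intro h
          exact hss (hinj s s' hlo hhi (Units.ext (sub_eq_zero.1 h)))
        have h0 : y (lo s) = 0 := by
          have : y (lo s) * ((ρ s : F) - ρ s') = 0 := by linear_combination hs - hs'
          exact (mul_eq_zero.1 this).resolve_right hρ
        have h1 : y (hi s) = 0 := by
          rw [h0, zero_mul, zero_sub, neg_eq_zero] at hs; exact hs
        funext l
        by_cases h : l = lo s
        · rw [h]; exact h0
        · by_cases h' : l = hi s
          · rw [h']; exact h1
          · exact hl l h h'
      · refine hcyc t y fun s hs => ?_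
        have := (hpair y s).symm.trans (hy (.inr s) hs)
        linear_combination -this

theorem partialProd_last {G : Type} [CommGroup G] {m : ℕ} (ρ : Fin m → G) :
    Fin.partialProd ρ (Fin.last m) = ∏ i, ρ i := by
  rw [Fin.partialProd, Fin.val_last, List.take_of_length_le (by simp), List.prod_ofFn]

/-- The linear recurrence along a path, closed up to a cycle, is nonsingular if and only if the
product of the ratios along the path differs from the ratio of the closing edge. -/
theorem cycle_nonsingular_iff {F : Type} [Field F] {m : ℕ} (ρ : Fin m → Fˣ) (τ : Fˣ) :
    (∀ y : Fin (m + 1) → F, (∀ i, y i.succ = ρ i * y i.castSucc) →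
      y (Fin.last m) = τ * y 0 → y = 0) ↔ ∏ i, ρ i ≠ τ := by
  constructor
  -- If the product equals the closing ratio, the partial products are a nonzero solution.
  · rintro h rfl
    have := h (fun i => (Fin.partialProd ρ i : Fˣ)) ?_ ?_
    · simpa using congrFun this 0
    · intro i
      simp [Fin.partialProd_succ, mul_comm]
    · rw [partialProd_last]; simp
  · intro h y hy hτ
    have key : ∀ i, y i = (Fin.partialProd ρ i : Fˣ) * y 0 := by
      intro i
      induction i using Fin.induction with
      | zero => simp
      | succ i ih => rw [hy, ih, Fin.partialProd_succ]; push_cast; ring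
    have h0 : y 0 = 0 := by
      have h1 := key (Fin.last m)
      rw [partialProd_last, hτ] at h1
      by_contra h0
      exact h (Units.ext (mul_right_cancel₀ h0 h1.symm))
    funext i
    rw [key i, h0, mul_zero]; rfl

/-- A network that is solvable if and only if there are `m` sets of `d` units whose product set is
proper, and at least `n` units. -/
theorem exists_network_iff_prod_ne (m d n : ℕ) [NeZero n] (hm : 2 ≤ m) :
    ∃ N : MulticastNetwork, ∀ (F : Type) [Field F], N.LinearlySolvable F ↔
      ∃ (c : Fin m → Fin d → Fˣ) (h : Fin n → Fˣ), (∀ i, Function.Injective (c i)) ∧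
        Function.Injective h ∧ ∀ j : Fin m → Fin d, ∏ i, c i (j i) ≠ h 0 := by
  -- A path on m + 1 vertices with d parallel edges per step, closed by n parallel edges. Each
  -- receiver takes one edge per step and closing edge 0; the other closing edges only force n
  -- distinct units. Since m ≥ 2, closing edges are not parallel to any step.
  let lo : (Fin m × Fin d) ⊕ Fin n → Fin (m + 1) := Sum.elim (fun s => s.1.castSucc) fun _ => 0
  let hi : (Fin m × Fin d) ⊕ Fin n → Fin (m + 1) :=
    Sum.elim (fun s => s.1.succ) fun _ => Fin.last m
  let sel : (Fin m → Fin d) → Set ((Fin m × Fin d) ⊕ Fin n) := fun j =>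
    insert (.inr 0) (Set.range fun i => .inl (i, j i))
  have hne : ∀ s, lo s ≠ hi s := by
    rintro (⟨i, a⟩ | a) heq
    · exact absurd heq (Fin.castSucc_lt_succ).ne
    · have := congrArg Fin.val heq
      simp [lo, hi] at this
      omega
  obtain ⟨N, hN⟩ := exists_network_iff_ratios lo hi hne sel fun j => Set.insert_nonempty _ _
  · refine ⟨N, fun F _ => (hN F).trans ?_⟩
    have hcyc : ∀ (ρ : (Fin m × Fin d) ⊕ Fin n → Fˣ) (j : Fin m → Fin d),
        (∀ y : Fin (m + 1) → F, (∀ s ∈ sel j, y (hi s) = ρ s * y (lo s)) → y = 0) ↔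
          ∏ i, ρ (.inl (i, j i)) ≠ ρ (.inr 0) := by
      intro ρ j
      rw [← cycle_nonsingular_iff]
      refine forall_congr' fun y => ?_
      simp only [sel, Set.forall_mem_insert, Set.forall_mem_range]
      exact ⟨fun h h1 h2 => h ⟨h2, h1⟩, fun h h1 => h h1.2 h1.1⟩
    constructor
    · rintro ⟨ρ, hinj, hρ⟩
      refine ⟨fun i a => ρ (.inl (i, a)), fun k => ρ (.inr k), ?_, ?_, fun j => ?_⟩
      · intro i a b hab
        simpa using hinj (.inl (i, a)) (.inl (i, b)) rfl rfl hab
      · intro a b hab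
        simpa using hinj (.inr a) (.inr b) rfl rfl hab
      · exact (hcyc ρ j).1 (hρ j)
    · rintro ⟨c, h, hc, hh, hprod⟩
      refine ⟨Sum.elim (fun s => c s.1 s.2) h, ?_, fun j => (hcyc _ j).2 (hprod j)⟩
      rintro (⟨i, a⟩ | a) (⟨i', b⟩ | b) hlo hhi hab
      · obtain rfl : i = i' := Fin.castSucc_injective _ hlo
        exact congrArg (fun t => Sum.inl (i, t)) (hc i hab)
      · have h1 := congrArg Fin.val hlo
        have h2 := congrArg Fin.val hhi
        simp [lo, hi] at h1 h2
        omega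
      · have h1 := congrArg Fin.val hlo
        have h2 := congrArg Fin.val hhi
        simp [lo, hi] at h1 h2
        omega
      · exact congrArg _ (hh hab)

end MulticastNetwork

/-! ### Solvability over specific fields, and the two extremal sizes -/

namespace MulticastNetwork

theorem exists_injective_apply_zero_eq {A : Type} [Finite A] {n : ℕ} [NeZero n]
    (hn : n ≤ Nat.card A) (x : A) : ∃ h : Fin n → A, Function.Injective h ∧ h 0 = x := by
  classical
  let e := Finite.equivFin A
  let u : Fin n → A := fun a => e.symm (Fin.castLE hn a)
  have hu : Function.Injective u := e.symm.injective.comp (Fin.castLE_injective hn)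
  exact ⟨fun a => Equiv.swap (u 0) x (u a), (Equiv.injective _).comp hu, Equiv.swap_apply_left _ _⟩

/-- In a large group, there are small sets whose product set is proper. -/
theorem exists_injective_prod_ne {G : Type} [CommGroup G] [Finite G] {m d n : ℕ} [NeZero n]
    (hm : m ≠ 0) (hG : d ^ m + n ≤ Nat.card G) :
    ∃ (c : Fin m → Fin d → G) (h : Fin n → G), (∀ i, Function.Injective (c i)) ∧
      Function.Injective h ∧ ∀ j : Fin m → Fin d, ∏ i, c i (j i) ≠ h 0 := by
  classical
  have := Fintype.ofFinite G
  have hd : d ≤ Nat.card G := (Nat.le_self_pow hm d).trans ((Nat.le_add_right _ _).trans hG)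
  let u : Fin d → G := fun a => (Finite.equivFin G).symm (Fin.castLE hd a)
  have hu : Function.Injective u :=
    (Finite.equivFin G).symm.injective.comp (Fin.castLE_injective hd)
  -- The product set has at most d^m elements, fewer than the group.
  obtain ⟨x, hx⟩ : ∃ x, x ∉ Finset.univ.image fun j : Fin m → Fin d => ∏ i, u (j i) := by
    by_contra! hall
    have h1 : Finset.univ.image (fun j : Fin m → Fin d => ∏ i, u (j i)) = Finset.univ :=
      Finset.eq_univ_of_forall hall
    have h2 := Finset.card_image_le (s := Finset.univ)
      (f := fun j : Fin m → Fin d => ∏ i, u (j i))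
    rw [h1, Finset.card_univ, Finset.card_univ, ← Nat.card_eq_fintype_card] at h2
    simp only [Fintype.card_pi, Fintype.card_fin, Finset.prod_const, Finset.card_univ] at h2
    have := NeZero.pos n
    omega
  obtain ⟨h, hh, h0⟩ := exists_injective_apply_zero_eq (n := n) (by omega) x
  refine ⟨fun _ => u, h, fun _ => hu, hh, fun j hj => hx ?_⟩
  exact Finset.mem_image.2 ⟨j, Finset.mem_univ _, hj.trans h0⟩

/-- In a cyclic group of order `d * r`, the subgroup of order `d` gives sets with a proper product
set. -/
theorem exists_injective_prod_ne_of_isCyclic {G : Type} [CommGroup G] [Finite G] [IsCyclic G]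
    (m : ℕ) {d r n : ℕ} [NeZero n] (hd : 0 < d) (hr : 2 ≤ r) (hG : Nat.card G = d * r)
    (hn : n ≤ Nat.card G) :
    ∃ (c : Fin m → Fin d → G) (h : Fin n → G), (∀ i, Function.Injective (c i)) ∧
      Function.Injective h ∧ ∀ j : Fin m → Fin d, ∏ i, c i (j i) ≠ h 0 := by
  obtain ⟨g, hg⟩ := IsCyclic.exists_generator (α := G)
  have ho : orderOf g = d * r := by rw [orderOf_eq_card_of_forall_mem_zpowers hg, hG]
  obtain ⟨h, hh, h0⟩ := exists_injective_apply_zero_eq hn g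
  refine ⟨fun _ a => g ^ (a.val * r), h, fun _ a b hab => ?_, hh, fun j hj => ?_⟩
  · have hlt : ∀ a : Fin d, a.val * r ∈ Set.Iio (orderOf g) := fun a => by
      rw [ho]; exact Nat.mul_lt_mul_of_pos_right a.2 (by omega)
    exact Fin.ext (Nat.eq_of_mul_eq_mul_right (by omega)
      (pow_injOn_Iio_orderOf (hlt a) (hlt b) hab))
  -- All products have trivial d-th power, whereas the generator `g` has order d * r > d.
  · have h1 : g ^ d = 1 := by
      rw [← h0, ← hj, ← Finset.prod_pow]
      refine Finset.prod_eq_one fun i _ => ?_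
      rw [← pow_mul, mul_assoc, mul_comm r d, ← ho, mul_comm, pow_mul, pow_orderOf_eq_one, one_pow]
    have h2 := orderOf_le_of_pow_eq_one hd h1
    rw [ho] at h2
    nlinarith

theorem exists_isQMax (N : MulticastNetwork) (B : ℕ)
    (hB : ∀ (F : Type) [Field F] [Finite F], B ≤ Nat.card F → N.LinearlySolvable F)
    {q : ℕ} (hq : q ∈ N.unsolvableSizes) : ∃ q', N.IsQMax q' ∧ q ≤ q' ∧ IsPrimePow q' := by
  have hbdd : BddAbove N.unsolvableSizes := by
    refine ⟨B, ?_⟩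
    rintro _ ⟨F, _, _, rfl, hF⟩
    by_contra hlt
    exact hF (hB F (not_le.1 hlt).le)
  have hmem := Nat.sSup_mem ⟨q, hq⟩ hbdd
  refine ⟨sSup N.unsolvableSizes, .inl ⟨hmem, fun x hx => le_csSup hbdd hx⟩,
    le_csSup hbdd hq, ?_⟩
  obtain ⟨F, _, _, hF, -⟩ := hmem
  have := Fintype.ofFinite F
  rw [← hF, Nat.card_eq_fintype_card]
  exact Fintype.isPrimePow_card_of_field

/-- The last hypothesis says that d exceeds (2 * 4^j - 1) / 7, the bound on proper subgroups of the
units of GF(2 * 4^j). -/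
theorem exists_network_isQMin_lt_isQMax {p k d r j : ℕ} (hp : p.Prime) (hk : k ≠ 0)
    (hr : 2 ≤ r) (hd : 0 < d) (hdr : p ^ k - 1 = d * r) (hlt : p ^ k < 2 * 4 ^ j)
    (hsub : 2 * 4 ^ j - 1 < d * 7) :
    ∃ q', IsPrimePow q' ∧ p ^ k < q' ∧ ∃ N : MulticastNetwork, N.IsQMin (p ^ k) ∧ N.IsQMax q' := by
  have hn : p ^ k - 1 ≠ 0 := by rw [hdr]; positivity
  have : NeZero (p ^ k - 1) := ⟨hn⟩
  have hm : 2 ≤ 2 * 4 ^ j := by have := Nat.one_le_pow j 4 (by norm_num); omega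
  obtain ⟨N, hN⟩ := exists_network_iff_prod_ne (2 * 4 ^ j) d (p ^ k - 1) hm
  have hmin : N.IsQMin (p ^ k) := by
    constructor
    · have := Fact.mk hp
      refine ⟨GaloisField p k, inferInstance, inferInstance, GaloisField.card p k hk, (hN _).2 ?_⟩
      have hcard : Nat.card (GaloisField p k)ˣ = p ^ k - 1 := by
        rw [Nat.card_units, GaloisField.card p k hk]
      exact exists_injective_prod_ne_of_isCyclic _ hd hr (hcard.trans hdr) hcard.ge
    · rintro _ ⟨F, _, _, rfl, hF⟩
      obtain ⟨_, h, _, hh, _⟩ := (hN F).1 hF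
      have := Nat.card_le_card_of_injective h hh
      rw [Nat.card_units, Nat.card_fin] at this
      omega
  have hunsol : 2 * 4 ^ j ∈ N.unsolvableSizes := by
    have hcard : Nat.card (GaloisField 2 (2 * j + 1)) = 2 * 4 ^ j := by
      rw [GaloisField.card 2 _ (by omega), pow_succ, pow_mul]
      norm_num [mul_comm]
    refine ⟨GaloisField 2 (2 * j + 1), inferInstance, inferInstance, hcard, fun hF => ?_⟩
    obtain ⟨c, h, hc, -, hne⟩ := (hN _).1 hF
    have hunits : Nat.card (GaloisField 2 (2 * j + 1))ˣ = 2 * 4 ^ j - 1 := by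
      rw [Nat.card_units, hcard]
    obtain ⟨a, ha⟩ := exists_prod_eq_of_proper_subgroup_card_lt hd (fun H hH => by
      have := card_subgroup_mul_seven_le hunits H hH
      omega) (by omega) c hc (h 0)
    exact hne a ha
  obtain ⟨q', hq', hle, hpow⟩ := exists_isQMax N (d ^ (2 * 4 ^ j) + (p ^ k - 1) + 1)
    (fun F _ _ hF => (hN F).2 (exists_injective_prod_ne (by omega) (by
      rw [Nat.card_units]; omega))) hunsol
  exact ⟨q', hpow, hlt.trans_le hle, N, hmin, hq'⟩

end MulticastNetwork

/-! ### Choice of exponents -/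

theorem corollary2 (p : ℕ) (hp : p.Prime) :
    {x : ℕ × ℕ | (∃ k : ℕ, 1 ≤ k ∧ x.1 = p ^ k) ∧ IsPrimePow x.2 ∧ x.1 < x.2 ∧
      ∃ N : MulticastNetwork, N.IsQMin x.1 ∧ N.IsQMax x.2}.Infinite := by
  refine Set.Infinite.of_image Prod.fst (Set.infinite_of_forall_exists_gt fun a => ?_)
  suffices h : ∃ k, a + 2 ≤ k ∧ ∃ q', IsPrimePow q' ∧ p ^ k < q' ∧
      ∃ N : MulticastNetwork, N.IsQMin (p ^ k) ∧ N.IsQMax q' by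
    obtain ⟨k, hk, q', h1, h2, h3⟩ := h
    have : k < p ^ k := Nat.lt_pow_self hp.one_lt
    exact ⟨p ^ k, ⟨(p ^ k, q'), ⟨⟨k, by omega, rfl⟩, h1, h2, h3⟩, rfl⟩, by omega⟩
  rcases hp.eq_two_or_odd' with rfl | hodd
  · have h4 : (4 : ℕ) ^ (a + 2) = 2 ^ (2 * (a + 2)) := by rw [pow_mul]; norm_num
    have h16 : 4 ^ 2 ≤ 4 ^ (a + 2) := Nat.pow_le_pow_right (by norm_num) (by omega)
    have hmod : 4 ^ (a + 2) % 3 = 1 := by rw [Nat.pow_mod]; simp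
    -- For p = 2 take p^k = 4^(a+2), divisible by 3 after subtracting 1, and the next power of two
    -- as the larger field.
    refine ⟨2 * (a + 2), by omega, MulticastNetwork.exists_network_isQMin_lt_isQMax
      (d := (4 ^ (a + 2) - 1) / 3) (r := 3) (j := a + 2) hp ?_ ?_ ?_ ?_ ?_ ?_⟩ <;>
      (try rw [← h4]) <;> omega
  · have key : ∀ k j, a + 2 ≤ k → p ^ k < 2 * 4 ^ j → 2 * 4 ^ j ≤ 3 * p ^ k →
        ∃ q', IsPrimePow q' ∧ p ^ k < q' ∧
          ∃ N : MulticastNetwork, N.IsQMin (p ^ k) ∧ N.IsQMax q' := by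
      intro k j hk h1 h2
      have h3 : 3 ≤ p := by
        have := hp.two_le
        rcases hodd with ⟨b, rfl⟩
        omega
      -- With d = (p^k - 1) / 2, the bound 3 p^k - 1 < 7 d holds once p^k > 5.
      have h9 : 3 ^ 2 ≤ p ^ k := (Nat.pow_le_pow_left h3 2).trans
        (Nat.pow_le_pow_right (by omega) (by omega))
      obtain ⟨b, hb⟩ := hodd.pow (n := k)
      exact MulticastNetwork.exists_network_isQMin_lt_isQMax (d := b) (r := 2) (j := j) hp (by omega) le_rfl
        (by omega) (by omega) h1 (by omega)
    rcases exists_two_mul_four_pow_le_three_mul (p ^ (a + 2)) (pow_pos hp.pos _) with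
      ⟨j, h1, h2⟩ | ⟨j, h1, h2⟩
    · exact ⟨a + 2, le_rfl, key _ j le_rfl h1 h2⟩
    · rw [← pow_mul] at h1 h2
      exact ⟨(a + 2) * 2, by omega, key _ j (by omega) h1 h2⟩
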